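/- Let $G$ be an étale, ample groupoid, where topological groupoids are assumed to be locally compact, second countable and Hausdorff; étale means that the range and source maps $r,s:G\to G$ are local homeomorphisms, and ample means that the compact open bisections form a basis of the topology of $G$ (an open bisection is an open set $E\subseteq G$ such that $r(E),s(E)$ are open and $r|_E:E\to r(E)$, $s|_E:E\to s(E)$ are homeomorphisms). Let $C^*_r(G)$ be the reduced $C^*$-algebra of $G$, that is, the completion of the convolution algebra $C_c(G)$ in the norm $\|f\|_r=\sup_{u\in G^{(0)}}\|\pi_u(f)\|$, where $\pi_u(f)\xi(\gamma)=\sum_{\alpha\beta=\gamma}f(\alpha)\xi(\beta)$ for $\xi\in\ell^2(G_u)$ and $\gamma\in G_u=\{\gamma\in G: s(\gamma)=u\}$. Suppose that $C^*_r(G)$ is stably finite, i.e. for every $n$ no projection $p\in M_n(C^*_r(G))$ is infinite, where $p$ is infinite if there is $v\in M_n(C^*_r(G))$ with $v^*v=p$, $vv^*\le p$ and $vv^*\neq p$. Then $G$ is completely non-paradoxical: for every nonempty compact open set $A\subseteq G^{(0)}$ of units and all integers $k>l>0$, the set $A$ is not $(k,l)$-paradoxical, i.e. there are no finitely many compact open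 bisections $E_1,\dots,E_n\subseteq G$ with $$k\,\mathbf 1_A\le\sum_{i=1}^n\mathbf 1_{s(E_i)}\qquad\text{and}\qquad\sum_{i=1}^n\mathbf 1_{r(E_i)}\le l\,\mathbf 1_A\quad\text{on } G^{(0)}.$$ -/

import Mathlib

open scoped ENNReal CompactlySupported

/-! ## Groupoids -/

/-- A groupoid, presented as a set `G` of arrows with a distinguished set of units, range and
source maps into the units, and a composition `mul α β` defined exactly when `s α = r β`. -/
class ArrowGroupoid (G : Type*) where
  /-- the unit space `G⁽⁰⁾` -/
  units : Set G
  /-- the range map -/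
  r : G → G
  /-- the source map -/
  s : G → G
  r_mem : ∀ α, r α ∈ units
  s_mem : ∀ α, s α ∈ units
  r_unit : ∀ u ∈ units, r u = u
  s_unit : ∀ u ∈ units, s u = u
  /-- the composition of a composable pair -/
  mul : ∀ α β : G, s α = r β → G
  r_mul : ∀ α β (h : s α = r β), r (mul α β h) = r α
  s_mul : ∀ α β (h : s α = r β), s (mul α β h) = s β
  mul_assoc : ∀ α β γ (h₁ : s α = r β) (h₂ : s β = r γ),
    mul (mul α β h₁) γ ((s_mul α β h₁).trans h₂) = mul α (mul β γ h₂) (h₁.trans (r_mul β γ h₂).symm)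
  r_mul_self : ∀ α, mul (r α) α (s_unit _ (r_mem α)) = α
  mul_s_self : ∀ α, mul α (s α) (r_unit _ (s_mem α)).symm = α
  /-- the inverse of an arrow -/
  inv : G → G
  r_inv : ∀ α, r (inv α) = s α
  s_inv : ∀ α, s (inv α) = r α
  mul_inv : ∀ α, mul α (inv α) (r_inv α).symm = r α
  inv_mul : ∀ α, mul (inv α) α (s_inv α) = s α

namespace ArrowGroupoid

variable {G : Type*} [ArrowGroupoid G]

theorem mul_congr {α α' β β' : G} (h : s α = r β) (hα : α = α') (hβ : β = β') :
    mul α β h = mul α' β' (by rw [← hα, ← hβ]; exact h) := by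
  subst hα; subst hβ; rfl

theorem mul_inv_mul_cancel (γ β : G) (h : s γ = r (inv β)) :
    mul (mul γ (inv β) h) β ((s_mul _ _ h).trans (s_inv β)) = γ := by
  rw [mul_assoc γ (inv β) β h (s_inv β)]
  have h' : s γ = s β := h.trans (r_inv β)
  rw [mul_congr _ rfl ((inv_mul β).trans h'.symm)]
  exact mul_s_self γ

theorem inv_mul_mul_cancel (γ δ : G) (h : s γ = r δ) :
    mul (inv γ) (mul γ δ h) ((s_inv γ).trans (r_mul _ _ h).symm) = δ := by
  rw [← mul_assoc (inv γ) γ δ (s_inv γ) h, mul_congr _ ((inv_mul γ).trans h) rfl]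
  exact r_mul_self δ

theorem inv_injective : Function.Injective (inv : G → G) := by
  intro β β' h
  have hs : s β = s β' := by rw [← r_inv, ← r_inv β', h]
  have hr : r β = r β' := by rw [← s_inv, ← s_inv β', h]
  have h1 := mul_inv_mul_cancel β β' (by rw [r_inv]; exact hs)
  rw [mul_congr _ ((mul_congr _ rfl h.symm).trans ((mul_inv β).trans hr)) rfl, r_mul_self] at h1
  exact h1.symm

/-- The source fibre `G_u = {γ ∈ G | s γ = u}`. -/
abbrev Fib (u : G) : Type _ := {γ : G // s γ = u}

/-- The arrow `γ β⁻¹` for `γ, β ∈ G_u`. This is the unique arrow `α` with `α β = γ`. -/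
def div {u : G} (γ β : Fib u) : G :=
  mul γ.1 (inv β.1) (by rw [r_inv, γ.2, β.2])

theorem s_div {u : G} (γ β : Fib u) : s (div γ β) = r β.1 :=
  (s_mul _ _ _).trans (s_inv _)

theorem r_div {u : G} (γ β : Fib u) : r (div γ β) = r γ.1 :=
  r_mul _ _ _

theorem div_mul {u : G} (γ β : Fib u) : mul (div γ β) β.1 (s_div γ β) = γ.1 :=
  mul_inv_mul_cancel _ _ _

theorem div_left_injective {u : G} (β : Fib u) : Function.Injective fun γ : Fib u => div γ β := by
  intro γ γ' h
  apply Subtype.ext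
  rw [← div_mul γ β, ← div_mul γ' β]
  exact mul_congr _ h rfl

theorem div_right_injective {u : G} (γ : Fib u) : Function.Injective fun β : Fib u => div γ β := by
  intro β β' h
  apply Subtype.ext
  apply inv_injective
  rw [← inv_mul_mul_cancel γ.1 (inv β.1) (by rw [r_inv, γ.2, β.2]),
    ← inv_mul_mul_cancel γ.1 (inv β'.1) (by rw [r_inv, γ.2, β'.2])]
  exact mul_congr _ rfl h

end ArrowGroupoid

/-- A topological groupoid: the set of composable pairs is closed, and composition and inversion
are continuous. -/
class IsTopGroupoid (G : Type*) [TopologicalSpace G] [ArrowGroupoid G] : Prop where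
  isClosed_composable : IsClosed {p : G × G | ArrowGroupoid.s p.1 = ArrowGroupoid.r p.2}
  continuous_mul : Continuous fun p : {p : G × G // ArrowGroupoid.s p.1 = ArrowGroupoid.r p.2} =>
    ArrowGroupoid.mul p.1.1 p.1.2 p.2
  continuous_inv : Continuous (ArrowGroupoid.inv : G → G)

/-- A topological groupoid is étale if `r, s : G → G` are local homeomorphisms. -/
class IsEtaleGroupoid (G : Type*) [TopologicalSpace G] [ArrowGroupoid G] : Prop
    extends IsTopGroupoid G where
  isLocalHomeomorph_r : IsLocalHomeomorph (ArrowGroupoid.r : G → G)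
  isLocalHomeomorph_s : IsLocalHomeomorph (ArrowGroupoid.s : G → G)

/-- An open bisection: an open set `E` such that `r(E)`, `s(E)` are open in `G` and
`r|_E : E → r(E)`, `s|_E : E → s(E)` are homeomorphisms. -/
def IsOpenBisection {G : Type*} [TopologicalSpace G] [ArrowGroupoid G] (E : Set G) : Prop :=
  IsOpen E ∧ Topology.IsOpenEmbedding (E.domRestrict (ArrowGroupoid.r : G → G)) ∧
    Topology.IsOpenEmbedding (E.domRestrict (ArrowGroupoid.s : G → G))

/-- A compact open bisection. -/
def IsCompactOpenBisection {G : Type*} [TopologicalSpace G] [ArrowGroupoid G] (E : Set G) : Prop :=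
  IsCompact E ∧ IsOpenBisection E

/-- A topological groupoid is ample if it has a basis of compact open bisections. -/
def IsAmpleGroupoid (G : Type*) [TopologicalSpace G] [ArrowGroupoid G] : Prop :=
  TopologicalSpace.IsTopologicalBasis {E : Set G | IsCompactOpenBisection E}

/-! ## Paradoxicality -/

/-- `A` is `(k,l)`-paradoxical: there are compact open bisections `E₁, …, Eₙ` with
`k 1_A ≤ ∑ᵢ 1_{s(Eᵢ)}` and `∑ᵢ 1_{r(Eᵢ)} ≤ l 1_A` as functions on the unit space. -/
def IsParadoxical {G : Type*} [TopologicalSpace G] [ArrowGroupoid G]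
    (A : Set G) (k l : ℕ) : Prop :=
  ∃ (n : ℕ) (E : Fin n → Set G), (∀ i, IsCompactOpenBisection (E i)) ∧
    ∀ u ∈ (ArrowGroupoid.units : Set G),
      k * A.indicator (1 : G → ℕ) u
          ≤ ∑ i, (ArrowGroupoid.s '' E i).indicator (1 : G → ℕ) u ∧
      ∑ i, (ArrowGroupoid.r '' E i).indicator (1 : G → ℕ) u
          ≤ l * A.indicator (1 : G → ℕ) u

/-- `G` is completely non-paradoxical: no nonempty compact open set of units is
`(k,l)`-paradoxical for any integers `k > l > 0`. -/
def IsCompletelyNonParadoxical (G : Type*) [TopologicalSpace G] [ArrowGroupoid G] : Prop :=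
  ∀ A : Set G, A ⊆ ArrowGroupoid.units → A.Nonempty → IsCompact A → IsOpen A →
    ∀ k l : ℕ, 0 < l → l < k → ¬ IsParadoxical A k l

/-! ## Stable finiteness -/

/-- A projection `p` is infinite if there is `v` with `v* v = p` and `v v* < p`, i.e. if it is
Murray-von Neumann equivalent to a proper subprojection of itself. -/
def IsInfiniteProjection {A : Type*} [NonUnitalRing A] [StarRing A] (p : A) : Prop :=
  IsStarProjection p ∧ ∃ v : A, star v * v = p ∧ p * (v * star v) = v * star v ∧ v * star v ≠ p

/-- `A` is stably finite if no matrix algebra `Mₙ(A)` contains an infinite projection. -/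
def IsStablyFiniteStarRing (A : Type*) [NonUnitalRing A] [StarRing A] : Prop :=
  ∀ (n : ℕ) (p : Matrix (Fin n) (Fin n) A), ¬ IsInfiniteProjection p

/-! ## Bounded operators on `ℓ²` given by kernels -/

/-- The Hilbert space `ℓ²(ι)`. -/
abbrev EllTwo (ι : Type*) : Type _ := lp (fun _ : ι => ℂ) 2

/-- The entries of `K` are bounded by `C`, and every row and column has at most `N` non-zero
entries. -/
structure IsKernelBound {ι : Type*} (K : ι → ι → ℂ) (C : ℝ) (N : ℕ) : Prop where
  nonneg : 0 ≤ C
  norm_le : ∀ a b, ‖K a b‖ ≤ C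
  row : ∀ a, {b | K a b ≠ 0}.encard ≤ N
  col : ∀ b, {a | K a b ≠ 0}.encard ≤ N

namespace IsKernelBound

variable {ι : Type*} {K : ι → ι → ℂ} {C : ℝ} {N : ℕ}

theorem row_finite (h : IsKernelBound K C N) (a : ι) : {b | K a b ≠ 0}.Finite :=
  Set.finite_of_encard_le_coe (h.row a)

theorem summable (h : IsKernelBound K C N) (ξ : ι → ℂ) (a : ι) :
    Summable fun b => K a b * ξ b := by
  apply summable_of_hasFiniteSupport
  exact (h.row_finite a).subset fun b hb => left_ne_zero_of_mul hb

open scoped Classical in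
theorem sum_le (h : IsKernelBound K C N) (ξ : EllTwo ι) (S : Finset ι) :
    ∑ a ∈ S, ‖∑' b, K a b * ξ b‖ ^ (2 : ℝ≥0∞).toReal
      ≤ (N * C * ‖ξ‖) ^ (2 : ℝ≥0∞).toReal := by
  have hC := h.nonneg
  let R : ι → Finset ι := fun a => (h.row_finite a).toFinset
  have hR : ∀ a b, b ∈ R a ↔ K a b ≠ 0 := fun a b => by simp [R]
  have hRc : ∀ a, (R a).card ≤ N := fun a => by
    have := h.row a
    rw [(h.row_finite a).encard_eq_coe_toFinset_card] at this
    exact_mod_cast this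
  let U := S.biUnion R
  have hcol : ∀ b, (S.filter fun a => b ∈ R a).card ≤ N := fun b => by
    have h1 : ((S.filter fun a => b ∈ R a : Finset ι) : Set ι).encard ≤ N := by
      refine (Set.encard_le_encard ?_).trans (h.col b)
      intro a ha
      have := (Finset.mem_filter.1 (Finset.mem_coe.1 ha)).2
      exact (hR a b).1 this
    rw [Set.encard_coe_eq_coe_finsetCard] at h1
    exact_mod_cast h1
  have hrow : ∀ a, ‖∑' b, K a b * ξ b‖ ^ 2 ≤ N * C ^ 2 * ∑ b ∈ R a, ‖ξ b‖ ^ 2 := fun a => by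
    rw [tsum_eq_sum (s := R a) (fun b hb => by
      have : K a b = 0 := by_contra fun h0 => hb ((hR a b).2 h0)
      simp [this])]
    calc ‖∑ b ∈ R a, K a b * ξ b‖ ^ 2
        ≤ (∑ b ∈ R a, C * ‖ξ b‖) ^ 2 := by
          gcongr
          refine norm_sum_le_of_le _ fun b _ => ?_
          rw [norm_mul]
          exact mul_le_mul_of_nonneg_right (h.norm_le a b) (norm_nonneg _)
      _ ≤ (R a).card * ∑ b ∈ R a, (C * ‖ξ b‖) ^ 2 := sq_sum_le_card_mul_sum_sq
      _ ≤ N * ∑ b ∈ R a, (C * ‖ξ b‖) ^ 2 := by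
          gcongr
          exact hRc a
      _ = N * C ^ 2 * ∑ b ∈ R a, ‖ξ b‖ ^ 2 := by
          simp only [mul_pow]
          rw [← Finset.mul_sum, mul_assoc]
  have hsw : ∑ a ∈ S, ∑ b ∈ R a, ‖ξ b‖ ^ 2 = ∑ b ∈ U, ∑ a ∈ S with b ∈ R a, ‖ξ b‖ ^ 2 := by
    apply Finset.sum_comm'
    intro a b
    simp only [U, Finset.mem_biUnion, Finset.mem_filter]
    exact ⟨fun hab => ⟨hab, a, hab⟩, fun hab => hab.1⟩
  have hU : ∑ b ∈ U, ‖ξ b‖ ^ 2 ≤ ‖ξ‖ ^ 2 := by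
    have := lp.sum_rpow_le_norm_rpow (p := 2) (by norm_num) ξ U
    simpa using this
  have key : ∑ a ∈ S, ‖∑' b, K a b * ξ b‖ ^ 2 ≤ (N * C * ‖ξ‖) ^ 2 :=
    calc ∑ a ∈ S, ‖∑' b, K a b * ξ b‖ ^ 2
        ≤ ∑ a ∈ S, N * C ^ 2 * ∑ b ∈ R a, ‖ξ b‖ ^ 2 := Finset.sum_le_sum fun a _ => hrow a
      _ = N * C ^ 2 * ∑ b ∈ U, ∑ a ∈ S with b ∈ R a, ‖ξ b‖ ^ 2 := by
          rw [← Finset.mul_sum, hsw]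
      _ ≤ N * C ^ 2 * ∑ b ∈ U, N * ‖ξ b‖ ^ 2 := by
          gcongr with b _
          rw [Finset.sum_const, nsmul_eq_mul]
          gcongr
          exact hcol b
      _ = (N * C) ^ 2 * ∑ b ∈ U, ‖ξ b‖ ^ 2 := by
          rw [← Finset.mul_sum]; ring
      _ ≤ (N * C) ^ 2 * ‖ξ‖ ^ 2 := by gcongr
      _ = (N * C * ‖ξ‖) ^ 2 := by ring
  simpa using key

theorem memℓp (h : IsKernelBound K C N) (ξ : EllTwo ι) :
    Memℓp (fun a => ∑' b, K a b * ξ b) 2 :=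
  memℓp_gen' (h.sum_le ξ)

end IsKernelBound

/-- The bounded operator on `ℓ²(ι)` with kernel `K`, given by `(Tξ)(a) = ∑_b K(a,b) ξ(b)`. -/
noncomputable def kernelOp {ι : Type*} (K : ι → ι → ℂ) (hK : ∃ C N, IsKernelBound K C N) :
    EllTwo ι →L[ℂ] EllTwo ι :=
  LinearMap.mkContinuousOfExistsBound
    { toFun := fun ξ => ⟨fun a => ∑' b, K a b * ξ b, hK.choose_spec.choose_spec.memℓp ξ⟩
      map_add' := fun ξ η => by
        obtain ⟨C, N, h⟩ := hK
        apply lp.ext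
        funext a
        change ∑' b, K a b * (ξ + η) b = ∑' b, K a b * ξ b + ∑' b, K a b * η b
        rw [← (h.summable ξ a).tsum_add (h.summable η a)]
        simp [mul_add]
      map_smul' := fun c ξ => by
        apply lp.ext
        funext a
        change ∑' b, K a b * (c • ξ) b = c * ∑' b, K a b * ξ b
        rw [← tsum_mul_left]
        simp [mul_left_comm] }
    (by
      obtain ⟨C, N, h⟩ := hK
      refine ⟨N * C, fun ξ => lp.norm_le_of_forall_sum_le (by norm_num) ?_ (h.sum_le ξ)⟩
      have := h.nonneg
      positivity)

theorem kernelOp_apply {ι : Type*} (K : ι → ι → ℂ) (hK : ∃ C N, IsKernelBound K C N)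
    (ξ : EllTwo ι) (a : ι) : kernelOp K hK ξ a = ∑' b, K a b * ξ b := rfl

theorem norm_kernelOp_le {ι : Type*} {K : ι → ι → ℂ} {C : ℝ} {N : ℕ} (h : IsKernelBound K C N)
    (hK : ∃ C N, IsKernelBound K C N) : ‖kernelOp K hK‖ ≤ N * C := by
  have := h.nonneg
  refine ContinuousLinearMap.opNorm_le_bound _ (by positivity) fun ξ => ?_
  exact lp.norm_le_of_forall_sum_le (by norm_num) (by positivity) (h.sum_le ξ)

/-! ## The reduced C*-algebra -/

theorem exists_encard_fiber_le {X Y : Type*} [TopologicalSpace X] [TopologicalSpace Y] {φ : X → Y}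
    (hφ : IsLocalHomeomorph φ) {S : Set X} (hS : IsCompact S) :
    ∃ N : ℕ, ∀ y, (S ∩ φ ⁻¹' {y}).encard ≤ N := by
  refine hS.induction_on (p := fun S => ∃ N : ℕ, ∀ y, (S ∩ φ ⁻¹' {y}).encard ≤ N) ?_ ?_ ?_ ?_
  · exact ⟨0, fun y => by simp⟩
  · rintro s t hst ⟨N, hN⟩
    exact ⟨N, fun y => (Set.encard_le_encard (Set.inter_subset_inter_left _ hst)).trans (hN y)⟩
  · rintro s t ⟨N, hN⟩ ⟨M, hM⟩
    refine ⟨N + M, fun y => ?_⟩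
    rw [Set.union_inter_distrib_right]
    refine (Set.encard_union_le _ _).trans ?_
    push_cast
    exact add_le_add (hN y) (hM y)
  · intro x _
    obtain ⟨e, hx, rfl⟩ := hφ x
    refine ⟨e.source, mem_nhdsWithin_of_mem_nhds (e.open_source.mem_nhds hx), 1, fun y => ?_⟩
    rw [Nat.cast_one, Set.encard_le_one_iff]
    rintro a b ⟨ha, hay⟩ ⟨hb, hby⟩
    exact e.injOn ha hb (hay.trans hby.symm)

section Reduced

open ArrowGroupoid

variable {G : Type*} [ArrowGroupoid G]

variable (G) in
/-- The C*-algebra of bounded families `(T_u)`, `T_u ∈ B(ℓ²(G_u))`, indexed by the units `u`, with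
pointwise operations and the supremum norm; it is the algebra of block-diagonal bounded operators
on the Hilbert space direct sum of the spaces `ℓ²(G_u)`. -/
def BlockOps : Type _ :=
  lp (fun u : (units : Set G) => EllTwo (Fib (u : G)) →L[ℂ] EllTwo (Fib (u : G))) ∞

noncomputable instance : NonUnitalCStarAlgebra (BlockOps G) :=
  inferInstanceAs (NonUnitalCStarAlgebra
    (lp (fun u : (units : Set G) => EllTwo (Fib (u : G)) →L[ℂ] EllTwo (Fib (u : G))) ∞))

/-- The component `T_u` of a family. -/
def BlockOps.comp (T : BlockOps G) (u : (units : Set G)) :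
    EllTwo (Fib (u : G)) →L[ℂ] EllTwo (Fib (u : G)) :=
  T.1 u

theorem BlockOps.ext {S T : BlockOps G} (h : ∀ u, S.comp u = T.comp u) : S = T :=
  Subtype.ext (funext h)

theorem BlockOps.add_comp (S T : BlockOps G) (u : (units : Set G)) :
    (S + T).comp u = S.comp u + T.comp u := rfl

theorem BlockOps.smul_comp (c : ℂ) (T : BlockOps G) (u : (units : Set G)) :
    (c • T).comp u = c • T.comp u := rfl

theorem BlockOps.mul_comp (S T : BlockOps G) (u : (units : Set G)) :
    (S * T).comp u = S.comp u * T.comp u := rfl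

theorem BlockOps.star_comp (T : BlockOps G) (u : (units : Set G)) :
    (star T).comp u = star (T.comp u) := rfl

theorem BlockOps.norm_eq (T : BlockOps G) : ‖T‖ = ⨆ u, ‖T.comp u‖ := rfl

variable [TopologicalSpace G] [IsEtaleGroupoid G]

theorem exists_isKernelBound (f : C_c(G, ℂ)) :
    ∃ (C : ℝ) (N : ℕ), ∀ u : G, IsKernelBound (fun γ β : Fib u => f (div γ β)) C N := by
  obtain ⟨C, hC⟩ := f.hasCompactSupport.exists_bound_of_continuous f.continuous
  obtain ⟨M, hM⟩ := exists_encard_fiber_le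
    (IsEtaleGroupoid.isLocalHomeomorph_r (G := G)) f.hasCompactSupport.isCompact
  obtain ⟨N, hN⟩ := exists_encard_fiber_le
    (IsEtaleGroupoid.isLocalHomeomorph_s (G := G)) f.hasCompactSupport.isCompact
  refine ⟨max C 0, max M N, fun u => ⟨le_max_right _ _, fun γ β => (hC _).trans (le_max_left _ _),
    fun γ => ?_, fun β => ?_⟩⟩
  · rw [← (div_right_injective γ).encard_image]
    refine (Set.encard_le_encard ?_).trans
      ((hM (r γ.1)).trans (by exact_mod_cast le_max_left M N))
    rintro _ ⟨β, hβ, rfl⟩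
    exact ⟨subset_tsupport _ hβ, r_div γ β⟩
  · rw [← (div_left_injective β).encard_image]
    refine (Set.encard_le_encard ?_).trans
      ((hN (r β.1)).trans (by exact_mod_cast le_max_right M N))
    rintro _ ⟨γ, hγ, rfl⟩
    exact ⟨subset_tsupport _ hγ, s_div γ β⟩

/-- The representation `π_u` of `C_c(G)` on `ℓ²(G_u)`:
`(π_u(f)ξ)(γ) = ∑_{αβ=γ} f(α) ξ(β) = ∑_{β ∈ G_u} f(γβ⁻¹) ξ(β)`. -/
noncomputable def fiberRep (u : G) (f : C_c(G, ℂ)) : EllTwo (Fib u) →L[ℂ] EllTwo (Fib u) :=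
  kernelOp (fun γ β : Fib u => f (div γ β))
    (let ⟨C, N, h⟩ := exists_isKernelBound f; ⟨C, N, h u⟩)

theorem fiberRep_apply (u : G) (f : C_c(G, ℂ)) (ξ : EllTwo (Fib u)) (γ : Fib u) :
    fiberRep u f ξ γ = ∑' β : Fib u, f (div γ β) * ξ β := rfl

/-- The direct sum `π_r = ⨁_u π_u`. -/
noncomputable def regRep (f : C_c(G, ℂ)) : BlockOps G :=
  ⟨fun u => fiberRep (u : G) f, by
    obtain ⟨C, N, h⟩ := exists_isKernelBound f
    refine memℓp_infty ⟨N * C, ?_⟩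
    rintro _ ⟨u, rfl⟩
    exact norm_kernelOp_le (h u) _⟩

theorem regRep_comp (f : C_c(G, ℂ)) (u : (units : Set G)) :
    (regRep f).comp u = fiberRep (u : G) f := rfl

variable (G) in
/-- The reduced C*-algebra of an étale groupoid: the completion of `C_c(G)` in the norm
`‖π_r(f)‖`, realised as the norm closure of the *-algebra of operators `π_r(f)`, `f ∈ C_c(G)`.
(For Hausdorff `G`, `π_r(f) π_r(g) = π_r(f * g)` and `π_r(f)* = π_r(f*)` for the convolution and
involution of `C_c(G)`, so the *-algebra generated by the `π_r(f)` consists of the `π_r(f)`.) -/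
noncomputable def reducedCStarAlgebra : NonUnitalStarSubalgebra ℂ (BlockOps G) :=
  (NonUnitalStarAlgebra.adjoin ℂ (Set.range (regRep : C_c(G, ℂ) → BlockOps G))).topologicalClosure

end Reduced

open ArrowGroupoid

/-! ## Cutting bisections into a matrix of compact open sets -/

/-! A `(k,l)`-paradox for `A` yields an infinite projection in `M_k` of the reduced C*-algebra,
namely `p = diag(1_A, …, 1_A)`. Label an arrow `γ ∈ E m` with `s γ ∈ A` by `(i,j)`: `j` counts the
earlier bisections whose source set contains `s γ`, and `i` counts the earlier ones whose range set
contains `r γ`. For `i, j < k` these labels cut the bisections into compact open sets `F i j`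
(`IsParadoxical.exists_matrix`). Every unit of `A` is the source of exactly one arrow in each
column. Within a row, arrows are determined by their ranges, which lie in `A`. Only the rows `i < l`
are nonempty. The matrix `v = (1_{F i j})` then satisfies `v* v = p` and `p v = v`, while row `l <
k` of `v` vanishes. Since `1_A ≠ 0`, this makes `v v*` a proper subprojection of `p`. -/

/-- A discrete intermediate value theorem: partial sums climb in steps of at most one, so each value
below the total is the level just before some jump. -/
theorem exists_sum_range_eq {f : ℕ → ℕ} (hf : ∀ m, f m ≤ 1) {j n : ℕ}
    (h : j < ∑ i ∈ Finset.range n, f i) :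
    ∃ m < n, f m = 1 ∧ ∑ i ∈ Finset.range m, f i = j := by
  induction n with
  | zero => simp at h
  | succ n ih =>
    by_cases h' : j < ∑ i ∈ Finset.range n, f i
    · obtain ⟨m, hm, hm'⟩ := ih h'
      exact ⟨m, by omega, hm'⟩
    · rw [Finset.sum_range_succ] at h
      have := hf n
      exact ⟨n, by omega, by omega, by omega⟩

/-- Partial sums increase strictly past a jump, so a jump is determined by its level. -/
theorem eq_of_sum_range_eq {f : ℕ → ℕ} {m n : ℕ} (hm : f m = 1) (hn : f n = 1)
    (h : ∑ i ∈ Finset.range m, f i = ∑ i ∈ Finset.range n, f i) : m = n := by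
  have aux : ∀ {m n : ℕ}, f m = 1 → m < n →
      ∑ i ∈ Finset.range m, f i < ∑ i ∈ Finset.range n, f i := fun {m n} hm hmn => by
    have := Finset.sum_le_sum_of_subset (f := f) (Finset.range_mono (Nat.succ_le_of_lt hmn))
    rw [Finset.sum_range_succ] at this
    omega
  rcases lt_trichotomy m n with hlt | heq | hlt
  · exact absurd h (aux hm hlt).ne
  · exact heq
  · exact absurd h (aux hn hlt).ne'

/-- The number of indices `i < m` with `u ∈ S i`. -/
noncomputable def countBefore {X : Type*} (S : ℕ → Set X) (m : ℕ) (u : X) : ℕ :=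
  ∑ i ∈ Finset.range m, (S i).indicator (1 : X → ℕ) u

theorem continuous_countBefore {X : Type*} [TopologicalSpace X] {S : ℕ → Set X}
    (hS : ∀ i, IsClopen (S i)) (m : ℕ) : Continuous (countBefore S m) :=
  continuous_finsetSum _ fun i _ => (hS i).continuous_indicator continuous_const

theorem exists_countBefore_eq {X : Type*} {S : ℕ → Set X} {n j : ℕ} {u : X}
    (h : j < countBefore S n u) : ∃ m < n, u ∈ S m ∧ countBefore S m u = j := by
  obtain ⟨m, hm, h1, h2⟩ := exists_sum_range_eq
    (fun m => Set.indicator_le_self' (fun _ _ => zero_le_one) u) h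
  refine ⟨m, hm, ?_, h2⟩
  by_contra hu
  simp [hu] at h1

theorem eq_of_countBefore_eq {X : Type*} {S : ℕ → Set X} {m n : ℕ} {u : X} (hm : u ∈ S m)
    (hn : u ∈ S n) (h : countBefore S m u = countBefore S n u) : m = n :=
  eq_of_sum_range_eq (by simp [hm]) (by simp [hn]) h

theorem countBefore_lt {X : Type*} {S : ℕ → Set X} {m n : ℕ} {u : X} (hmn : m < n)
    (hm : u ∈ S m) : countBefore S m u < countBefore S n u := by
  have := Finset.sum_le_sum_of_subset (f := fun i => (S i).indicator (1 : X → ℕ) u)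
    (Finset.range_mono (Nat.succ_le_of_lt hmn))
  rw [Finset.sum_range_succ] at this
  simp only [Set.indicator_of_mem hm, Pi.one_apply] at this
  exact this

/-- The column index is the rank of an arrow over its source, the row index its rank over its range.
Ranks over a unit of `A` take every value below `k` on the source side and only values below `l` on
the range side. -/
theorem IsParadoxical.exists_matrix {G : Type*} [TopologicalSpace G] [T2Space G] [ArrowGroupoid G]
    [IsEtaleGroupoid G] {A : Set G} {k l : ℕ} (hAu : A ⊆ units) (hA : IsCompact A) (hAo : IsOpen A)
    (hlk : l < k) (h : IsParadoxical A k l) :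
    ∃ F : Fin k → Fin k → Set G, (∀ i j, IsCompact (F i j)) ∧ (∀ i j, IsOpen (F i j)) ∧
      (∀ i j, ∀ γ ∈ F i j, s γ ∈ A ∧ r γ ∈ A ∧ (i : ℕ) < l) ∧
      (∀ u ∈ A, ∀ j, ∃ i, ∃ γ ∈ F i j, s γ = u) ∧
      (∀ i i' j, ∀ γ ∈ F i j, ∀ δ ∈ F i' j, s γ = s δ → i = i' ∧ γ = δ) ∧
      ∀ i j j', ∀ γ ∈ F i j, ∀ δ ∈ F i j', r γ = r δ → j = j' ∧ γ = δ := by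
  obtain ⟨n, E₀, hE₀, hpar⟩ := h
  -- Padding by `∅` allows indexing by `ℕ`, as `countBefore` requires.
  let E : ℕ → Set G := fun m => if h : m < n then E₀ ⟨m, h⟩ else ∅
  have hEE : ∀ i : Fin n, E i = E₀ i := fun i => by simp [E]
  have hE : ∀ m, IsCompactOpenBisection (E m) ∨ E m = ∅ := fun m => by
    by_cases h : m < n
    · left; simpa [E, h] using hE₀ ⟨m, h⟩
    · right; simp [E, h]
  have hEc : ∀ m, IsCompact (E m) := fun m =>
    (hE m).elim (fun h => h.1) fun h => h ▸ isCompact_empty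
  have hEo : ∀ m, IsOpen (E m) := fun m =>
    (hE m).elim (fun h => h.2.1) fun h => h ▸ isOpen_empty
  have hEr : ∀ m, Set.InjOn r (E m) := fun m =>
    (hE m).elim (fun h => Set.injOn_iff_injective.2 h.2.2.1.injective) fun h => by simp [h]
  have hEs : ∀ m, Set.InjOn s (E m) := fun m =>
    (hE m).elim (fun h => Set.injOn_iff_injective.2 h.2.2.2.injective) fun h => by simp [h]
  have hr := IsEtaleGroupoid.isLocalHomeomorph_r (G := G)
  have hs := IsEtaleGroupoid.isLocalHomeomorph_s (G := G)
  let S : ℕ → Set G := fun m => s '' E m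
  let R : ℕ → Set G := fun m => r '' E m
  have hS : ∀ m, IsClopen (S m) := fun m =>
    ⟨((hEc m).image hs.continuous).isClosed, hs.isOpenMap _ (hEo m)⟩
  have hR : ∀ m, IsClopen (R m) := fun m =>
    ⟨((hEc m).image hr.continuous).isClosed, hr.isOpenMap _ (hEo m)⟩
  have hk : ∀ u ∈ A, k ≤ countBefore S n u := fun u hu => by
    have := (hpar u (hAu hu)).1
    simp only [Set.indicator_of_mem hu, Pi.one_apply, mul_one, ← hEE] at this
    rwa [Fin.sum_univ_eq_sum_range (fun i => (s '' E i).indicator (1 : G → ℕ) u)] at this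
  have hl : ∀ u ∈ units, countBefore R n u ≤ l * A.indicator (1 : G → ℕ) u := fun u hu => by
    have := (hpar u hu).2
    simp only [← hEE] at this
    rwa [Fin.sum_univ_eq_sum_range (fun i => (r '' E i).indicator (1 : G → ℕ) u)] at this
  -- `E m` itself contributes to the full count at `r γ`, so the count before `m` is strictly
  -- smaller. Off `A` the full count is zero, which is impossible.
  have hrA : ∀ m < n, ∀ γ ∈ E m, r γ ∈ A ∧ countBefore R m (r γ) < l := fun m hm γ hγ => by
    have h1 := countBefore_lt (S := R) hm ⟨γ, hγ, rfl⟩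
    have h2 := hl _ (r_mem γ)
    by_cases hA : r γ ∈ A
    · simp only [Set.indicator_of_mem hA, Pi.one_apply, mul_one] at h2
      exact ⟨hA, h1.trans_le h2⟩
    · simp only [Set.indicator_of_notMem hA, mul_zero] at h2
      omega
  let T : ℕ → ℕ → ℕ → Set G := fun i j m =>
    s ⁻¹' (A ∩ countBefore S m ⁻¹' {j}) ∩ r ⁻¹' (countBefore R m ⁻¹' {i})
  have hT : ∀ i j m, IsClopen (T i j m) := fun i j m =>
    ((IsClopen.inter ⟨hA.isClosed, hAo⟩
      ((isClopen_discrete _).preimage (continuous_countBefore hS m))).preimage hs.continuous).inter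
      (((isClopen_discrete _).preimage (continuous_countBefore hR m)).preimage hr.continuous)
  refine ⟨fun i j => ⋃ m ∈ Finset.range n, E m ∩ T i j m, fun i j => ?_, fun i j => ?_, ?_, ?_, ?_,
    ?_⟩
  · exact (Finset.range n).isCompact_biUnion fun m _ => (hEc m).inter_right (hT i j m).1
  · exact isOpen_biUnion fun m _ => (hEo m).inter (hT i j m).2
  · intro i j γ hγ
    simp only [Set.mem_iUnion, Finset.mem_range] at hγ
    obtain ⟨m, hm, hγE, ⟨hγA, -⟩, hγR⟩ := hγ
    obtain ⟨h1, h2⟩ := hrA m hm γ hγE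
    exact ⟨hγA, h1, (Set.mem_singleton_iff.1 hγR) ▸ h2⟩
  · intro u hu j
    obtain ⟨m, hm, ⟨γ, hγ, rfl⟩, hj⟩ := exists_countBefore_eq (j.2.trans_le (hk u hu))
    -- The row is forced to be the rank of `γ` over its range.
    refine ⟨⟨countBefore R m (r γ), (hrA m hm γ hγ).2.trans hlk⟩, γ, ?_, rfl⟩
    simp only [Set.mem_iUnion, Finset.mem_range]
    exact ⟨m, hm, hγ, ⟨hu, hj⟩, rfl⟩
  · intro i i' j γ hγ δ hδ hs
    simp only [Set.mem_iUnion, Finset.mem_range] at hγ hδ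
    obtain ⟨m, hm, hγE, ⟨hγA, hγS⟩, hγR⟩ := hγ
    obtain ⟨m', hm', hδE, ⟨hδA, hδS⟩, hδR⟩ := hδ
    simp only [Set.mem_preimage, Set.mem_singleton_iff] at hγS hγR hδS hδR
    -- Equal source and equal source rank force the same bisection, on which `s` is injective.
    obtain rfl : m = m' := eq_of_countBefore_eq (S := S) (u := s γ) ⟨γ, hγE, rfl⟩
      ⟨δ, hδE, hs.symm⟩ (by rw [hγS, hs, hδS])
    obtain rfl := hEs m hγE hδE hs
    exact ⟨Fin.ext (hγR.symm.trans hδR), rfl⟩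
  · intro i j j' γ hγ δ hδ hr
    simp only [Set.mem_iUnion, Finset.mem_range] at hγ hδ
    obtain ⟨m, hm, hγE, ⟨hγA, hγS⟩, hγR⟩ := hγ
    obtain ⟨m', hm', hδE, ⟨hδA, hδS⟩, hδR⟩ := hδ
    simp only [Set.mem_preimage, Set.mem_singleton_iff] at hγS hγR hδS hδR
    obtain rfl : m = m' := eq_of_countBefore_eq (S := R) (u := r γ) ⟨γ, hγE, rfl⟩
      ⟨δ, hδE, hr.symm⟩ (by rw [hγR, hr, hδR])
    obtain rfl := hEr m hγE hδE hr
    exact ⟨Fin.ext (hγS.symm.trans hδS), rfl⟩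

/-! ## Indicator functions of compact open sets in the reduced C*-algebra -/

namespace ArrowGroupoid

variable {G : Type*} [ArrowGroupoid G]

theorem div_mul_right {u : G} (α : G) (β : Fib u) (h : s α = r β.1) :
    div (⟨mul α β.1 h, (s_mul _ _ _).trans β.2⟩ : Fib u) β = α := by
  change mul (mul α β.1 h) (inv β.1) _ = α
  rw [mul_assoc α β.1 (inv β.1) h (r_inv _).symm]
  rw [mul_congr _ rfl ((mul_inv β.1).trans h.symm)]
  exact mul_s_self α

theorem div_self_eq_r {u : G} (γ : Fib u) : div γ γ = r γ.1 := mul_inv γ.1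

/-- This is why functions supported on the units act diagonally. -/
theorem eq_of_div_mem_units {u : G} {γ β : Fib u} (h : div γ β ∈ units) : γ = β := by
  apply Subtype.ext
  rw [← div_mul γ β, mul_congr _ (((s_unit _ h).symm.trans (s_div γ β))) rfl]
  exact r_mul_self β.1

end ArrowGroupoid

/-- The indicator function of a compact open set, as an element of `C_c(X)`. -/
noncomputable def ccIndicator {X : Type*} [TopologicalSpace X] [T2Space X] {F : Set X}
    (hc : IsCompact F) (ho : IsOpen F) : C_c(X, ℂ) where
  toFun := F.indicator 1
  continuous_toFun := IsClopen.continuous_indicator ⟨hc.isClosed, ho⟩ continuous_const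
  hasCompactSupport' := HasCompactSupport.intro hc fun _ hx => Set.indicator_of_notMem hx _

theorem ccIndicator_apply {X : Type*} [TopologicalSpace X] [T2Space X] {F : Set X}
    (hc : IsCompact F) (ho : IsOpen F) (x : X) : ccIndicator hc ho x = F.indicator 1 x := rfl

/-! ### Matrix coefficients of operators on `ℓ²(G_u)` -/

section
open scoped Classical

/-- The standard basis vector `δ_b` of `ℓ²(ι)`. -/
noncomputable def basisVec {ι : Type*} (b : ι) : EllTwo ι := lp.single 2 b 1

theorem inner_basisVec_left {ι : Type*} (a : ι) (ξ : EllTwo ι) : inner ℂ (basisVec a) ξ = ξ a := by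
  rw [basisVec, lp.inner_single_left]
  simp

theorem ext_basisVec {ι : Type*} {S T : EllTwo ι →L[ℂ] EllTwo ι}
    (h : ∀ b a, S (basisVec b) a = T (basisVec b) a) : S = T := by
  apply lp.ext_continuousLinearMap (by norm_num)
  intro b
  ext a
  exact congrArg (fun f : ι → ℂ => f _) (funext (h b))

/-- Expresses `S* T` through the columns of `S` and `T` alone, so neither the convolution nor the
involution of `C_c(G)` has to be computed. -/
theorem star_mul_basisVec {ι : Type*} (S T : EllTwo ι →L[ℂ] EllTwo ι) (a b : ι) :
    (star S * T) (basisVec b) a = ∑' c, star (S (basisVec a) c) * T (basisVec b) c := by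
  rw [← inner_basisVec_left, ContinuousLinearMap.star_eq_adjoint, mul_apply_eq_comp,
    ContinuousLinearMap.adjoint_inner_right, lp.inner_eq_tsum]
  simp [mul_comm]

variable {G : Type*} [ArrowGroupoid G] [TopologicalSpace G] [IsEtaleGroupoid G]

theorem fiberRep_basisVec (u : G) (f : C_c(G, ℂ)) (β γ : Fib u) :
    fiberRep u f (basisVec β) γ = f (div γ β) := by
  rw [fiberRep_apply, tsum_eq_single β]
  · simp [basisVec]
  · intro b hb
    simp [basisVec, hb]

theorem fiberRep_ccIndicator_of_subset_units [T2Space G] {A : Set G} (hc : IsCompact A)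
    (ho : IsOpen A) (hAu : A ⊆ units) (u : G) (ξ : EllTwo (Fib u)) (γ : Fib u) :
    fiberRep u (ccIndicator hc ho) ξ γ = A.indicator 1 (r γ.1) * ξ γ := by
  rw [fiberRep_apply, tsum_eq_single γ]
  · rw [ccIndicator_apply, div_self_eq_r]
  · intro b hb
    rw [ccIndicator_apply, Set.indicator_of_notMem, zero_mul]
    exact fun h => hb (eq_of_div_mem_units (hAu h)).symm

end

/-! ### Relations between indicators in the reduced C*-algebra -/

section

variable {G : Type*} [ArrowGroupoid G] [TopologicalSpace G] [IsEtaleGroupoid G]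

variable (G) in
/-- The component at the unit `u` of an element of the reduced C*-algebra. -/
noncomputable def reducedComp (u : (units : Set G)) :
    reducedCStarAlgebra G →+ (EllTwo (Fib (u : G)) →L[ℂ] EllTwo (Fib (u : G))) where
  toFun T := T.1.comp u
  map_zero' := rfl
  map_add' _ _ := rfl

theorem reducedComp_ext {S T : reducedCStarAlgebra G}
    (h : ∀ u, reducedComp G u S = reducedComp G u T) : S = T :=
  Subtype.ext (BlockOps.ext h)

theorem reducedComp_mul (S T : reducedCStarAlgebra G) (u : (units : Set G)) :
    reducedComp G u (S * T) = reducedComp G u S * reducedComp G u T := rfl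

theorem reducedComp_star (T : reducedCStarAlgebra G) (u : (units : Set G)) :
    reducedComp G u (star T) = star (reducedComp G u T) := rfl

variable [T2Space G]

/-- The indicator function of a compact open set, as an element of the reduced C*-algebra. -/
noncomputable def reducedIndicator {F : Set G} (hc : IsCompact F) (ho : IsOpen F) :
    reducedCStarAlgebra G :=
  ⟨regRep (ccIndicator hc ho), NonUnitalStarSubalgebra.le_topologicalClosure _
    (NonUnitalStarAlgebra.subset_adjoin ℂ _ ⟨_, rfl⟩)⟩

theorem reducedComp_reducedIndicator {F : Set G} (hc : IsCompact F) (ho : IsOpen F)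
    (u : (units : Set G)) :
    reducedComp G u (reducedIndicator hc ho) = fiberRep (u : G) (ccIndicator hc ho) := rfl

theorem reducedIndicator_empty {F : Set G} (hc : IsCompact F) (ho : IsOpen F) (hF : F = ∅) :
    reducedIndicator hc ho = 0 := by
  refine reducedComp_ext fun u => ext_basisVec fun β γ => ?_
  rw [reducedComp_reducedIndicator, fiberRep_basisVec, map_zero, ccIndicator_apply]
  simp [hF]

theorem reducedIndicator_ne_zero {A : Set G} (hc : IsCompact A) (ho : IsOpen A)
    (hAu : A ⊆ units) (hA : A.Nonempty) : reducedIndicator hc ho ≠ 0 := by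
  obtain ⟨u, hu⟩ := hA
  intro h
  have h1 := congrArg (reducedComp G ⟨u, hAu hu⟩) h
  let β : Fib u := ⟨u, s_unit u (hAu hu)⟩
  have h2 : fiberRep u (ccIndicator hc ho) (basisVec β) β = 0 := by
    change reducedComp G ⟨u, hAu hu⟩ (reducedIndicator hc ho) (basisVec β) β = 0
    rw [h1, map_zero]
    rfl
  rw [fiberRep_basisVec, div_self_eq_r, r_unit u (hAu hu), ccIndicator_apply,
    Set.indicator_of_mem hu] at h2
  exact one_ne_zero h2

theorem reducedIndicator_mul_of_range_subset {A F : Set G} (hc : IsCompact A) (ho : IsOpen A)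
    (hAu : A ⊆ units) (hFc : IsCompact F) (hFo : IsOpen F) (hF : ∀ γ ∈ F, r γ ∈ A) :
    reducedIndicator hc ho * reducedIndicator hFc hFo = reducedIndicator hFc hFo := by
  refine reducedComp_ext fun u => ext_basisVec fun β γ => ?_
  simp only [reducedComp_mul, reducedComp_reducedIndicator]
  rw [mul_apply_eq_comp, fiberRep_ccIndicator_of_subset_units hc ho hAu,
    fiberRep_basisVec, ccIndicator_apply]
  by_cases h : div γ β ∈ F
  · rw [← r_div γ β, Set.indicator_of_mem (hF _ h), Pi.one_apply, one_mul]
  · rw [Set.indicator_of_notMem h, mul_zero]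

/-- Off-diagonal entries of `v* v`. A nonzero term of a coefficient would need `γβ'⁻¹ ∈ F i` and
`γβ⁻¹ ∈ F' i`, two arrows with the same range `r γ`. -/
theorem sum_star_reducedIndicator_mul_of_ne {k : ℕ} {F F' : Fin k → Set G}
    (hc : ∀ i, IsCompact (F i)) (ho : ∀ i, IsOpen (F i)) (hc' : ∀ i, IsCompact (F' i))
    (ho' : ∀ i, IsOpen (F' i)) (hr : ∀ i, ∀ γ ∈ F i, ∀ δ ∈ F' i, r γ ≠ r δ) :
    ∑ i, star (reducedIndicator (hc i) (ho i)) * reducedIndicator (hc' i) (ho' i) = 0 := by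
  refine Finset.sum_eq_zero fun i _ => reducedComp_ext fun u => ext_basisVec fun β β' => ?_
  simp only [reducedComp_mul, reducedComp_star, reducedComp_reducedIndicator, map_zero]
  rw [star_mul_basisVec]
  refine (tsum_congr fun γ => ?_).trans tsum_zero
  simp only [fiberRep_basisVec, ccIndicator_apply]
  by_cases h : div γ β' ∈ F i
  · rw [Set.indicator_of_notMem (s := F' i) fun h' => hr i _ h _ h' (by rw [r_div, r_div]),
      mul_zero]
  · rw [Set.indicator_of_notMem h, star_zero, zero_mul]

/-- Diagonal entries of `v* v`. The coefficient at `(β,β)` counts the arrows of the column with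
source `r β`: one if `r β ∈ A`, none otherwise. -/
theorem sum_star_reducedIndicator_mul_self {k : ℕ} {A : Set G} (hAc : IsCompact A)
    (hAo : IsOpen A) (hAu : A ⊆ units) {F : Fin k → Set G}
    (hc : ∀ i, IsCompact (F i)) (ho : ∀ i, IsOpen (F i)) (hsA : ∀ i, ∀ γ ∈ F i, s γ ∈ A)
    (hex : ∀ u ∈ A, ∃ i, ∃ γ ∈ F i, s γ = u)
    (hs : ∀ i i', ∀ γ ∈ F i, ∀ δ ∈ F i', s γ = s δ → i = i' ∧ γ = δ)
    (hr : ∀ i, Set.InjOn r (F i)) :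
    ∑ i, star (reducedIndicator (hc i) (ho i)) * reducedIndicator (hc i) (ho i)
      = reducedIndicator hAc hAo := by
  refine reducedComp_ext fun u => ext_basisVec fun β β' => ?_
  simp only [map_sum, reducedComp_mul, reducedComp_star, reducedComp_reducedIndicator]
  rw [sum_apply, lp.coeFn_sum, Finset.sum_apply]
  simp only [star_mul_basisVec, fiberRep_basisVec, ccIndicator_apply]
  by_cases hβ : β' = β
  · subst hβ
    rw [div_self_eq_r]
    by_cases hA : r β'.1 ∈ A
    · obtain ⟨i, α, hα, hαs⟩ := hex _ hA
      have hdiv := div_mul_right α β' hαs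
      -- With `α` the only arrow of the column over `r β'`, the surviving term is `γ = αβ'`.
      rw [Finset.sum_eq_single i, tsum_eq_single ⟨mul α β'.1 hαs, (s_mul _ _ _).trans β'.2⟩]
      · simp [hdiv, hα, hA]
      · intro γ hγ
        rw [Set.indicator_of_notMem (s := F i), mul_zero]
        intro h
        refine hγ (div_left_injective β' ?_)
        exact ((hs i i _ h _ hα (by rw [s_div, hαs])).2).trans hdiv.symm
      · intro i' _ hi'
        refine (tsum_congr fun γ => ?_).trans tsum_zero
        rw [Set.indicator_of_notMem (s := F i'), mul_zero]
        exact fun h => hi' (hs i' i _ h _ hα (by rw [s_div, hαs])).1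
      · simp
    · rw [Set.indicator_of_notMem hA]
      refine Finset.sum_eq_zero fun i _ => (tsum_congr fun γ => ?_).trans tsum_zero
      rw [Set.indicator_of_notMem (s := F i), mul_zero]
      exact fun h => hA (s_div γ β' ▸ hsA i _ h)
  · rw [Set.indicator_of_notMem (s := A) fun h => hβ (eq_of_div_mem_units (hAu h))]
    refine Finset.sum_eq_zero fun i _ => (tsum_congr fun γ => ?_).trans tsum_zero
    -- If `γβ'⁻¹` and `γβ⁻¹` were both in `F i`, their common range `r γ` and injectivity of `r` on
    -- `F i` would give `β' = β`.
    by_cases h : div γ β' ∈ F i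
    · rw [Set.indicator_of_notMem (s := F i) (a := div γ β), mul_zero]
      exact fun h' => hβ (div_right_injective γ (hr i h h' (by rw [r_div, r_div])))
    · rw [Set.indicator_of_notMem h, star_zero, zero_mul]

end

/-! ### The infinite projection -/

theorem IsParadoxical.exists_isInfiniteProjection {G : Type*} [TopologicalSpace G] [T2Space G]
    [ArrowGroupoid G] [IsEtaleGroupoid G] {A : Set G} {k l : ℕ} (hAu : A ⊆ units)
    (hne : A.Nonempty) (hA : IsCompact A) (hAo : IsOpen A) (hlk : l < k)
    (h : IsParadoxical A k l) :
    IsInfiniteProjection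
      (Matrix.diagonal fun _ => reducedIndicator hA hAo :
        Matrix (Fin k) (Fin k) (reducedCStarAlgebra G)) := by
  obtain ⟨F, hc, ho, hsub, hex, hs, hr⟩ := h.exists_matrix hAu hA hAo hlk
  let v : Matrix (Fin k) (Fin k) (reducedCStarAlgebra G) :=
    Matrix.of fun i j => reducedIndicator (hc i j) (ho i j)
  set p : Matrix (Fin k) (Fin k) (reducedCStarAlgebra G) :=
    Matrix.diagonal fun _ => reducedIndicator hA hAo with hp
  have hv : star v * v = p := by
    ext1 j j'
    rw [Matrix.mul_apply]
    simp only [Matrix.star_apply, v, Matrix.of_apply]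
    by_cases hjj : j = j'
    · subst hjj
      rw [hp, Matrix.diagonal_apply_eq]
      exact sum_star_reducedIndicator_mul_self hA hAo hAu (fun i => hc i j) (fun i => ho i j)
        (fun i γ hγ => (hsub i j γ hγ).1) (fun u hu => hex u hu j) (fun i i' => hs i i' j)
        fun i γ hγ δ hδ h => (hr i j j γ hγ δ hδ h).2
    · rw [hp, Matrix.diagonal_apply_ne _ hjj]
      exact sum_star_reducedIndicator_mul_of_ne (fun i => hc i j) (fun i => ho i j)
        (fun i => hc i j') (fun i => ho i j') fun i γ hγ δ hδ h => hjj (hr i j j' γ hγ δ hδ h).1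
  have hpv : p * v = v := by
    ext1 i j
    rw [hp, Matrix.diagonal_mul]
    exact reducedIndicator_mul_of_range_subset hA hAo hAu _ _ fun γ hγ => (hsub i j γ hγ).2.1
  have hpp : p * p = p := by
    rw [hp, Matrix.diagonal_mul_diagonal]
    exact congrArg Matrix.diagonal (funext fun _ =>
      reducedIndicator_mul_of_range_subset hA hAo hAu hA hAo fun γ hγ =>
        (r_unit γ (hAu hγ)).symm ▸ hγ)
  -- Self-adjointness of `p` comes for free from `p = v* v`.
  refine ⟨⟨hpp, hv ▸ IsSelfAdjoint.star_mul_self v⟩, v, hv, by rw [← _root_.mul_assoc, hpv], fun h => ?_⟩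
  -- Row `l` exists because `l < k`, and is empty because row indices of arrows are below `l`. So
  -- the `(l,l)` entry of `v v*` is `0`, whereas that of `p` is `1_A`.
  have hv0 : ∀ j, v ⟨l, hlk⟩ j = 0 := fun j =>
    reducedIndicator_empty _ _ (Set.eq_empty_of_forall_notMem fun γ hγ =>
      lt_irrefl l (hsub ⟨l, hlk⟩ j γ hγ).2.2)
  have h0 := congrFun (congrFun h ⟨l, hlk⟩) ⟨l, hlk⟩
  rw [hp, Matrix.diagonal_apply_eq, Matrix.mul_apply,
    Finset.sum_eq_zero fun j _ => by rw [hv0 j, zero_mul]] at h0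
  exact reducedIndicator_ne_zero hA hAo hAu hne h0.symm

theorem mainTheorem5 (G : Type*) [TopologicalSpace G] [T2Space G] [LocallyCompactSpace G]
    [SecondCountableTopology G] [ArrowGroupoid G] [IsEtaleGroupoid G]
    (hG : IsAmpleGroupoid G) (hfin : IsStablyFiniteStarRing (reducedCStarAlgebra G)) :
    IsCompletelyNonParadoxical G :=
  fun _ hAu hne hA hAo _ _ _ hlk h =>
    hfin _ _ (h.exists_isInfiniteProjection hAu hne hA hAo hlk)
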